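/- A rooted binary tree is a tree in which every vertex has valence one or three, with a distinguished exterior edge $e_*$, the root edge; the other exterior edges are its ends. For $n \ge 1$ let $\mathrm{Tree}(n)$ be the set of rooted binary trees whose ends are labeled bijectively by $0, 1, \dots, n$, up to homeomorphisms preserving the root and the labels. Each edge that is neither the root edge nor an end is called interior. A Whitehead move on an interior edge collapses it and reopens the resulting $4$-valent vertex in one of the two other ways. A simultaneous Whitehead move on $T$ is a composition of Whitehead moves on arbitrarily many interior edges of $T$, no two of which share a vertex. Let $d_S$ be the path metric on $\mathrm{Tree}(n)$ in which two distinct trees are at distance $1$ if and only if they differ by a simultaneous Whitehead move. The height of an edge is the number of edges on the path from it to $e_*$, both included (so $e_*$ has height $1$ and its children have height $2$), and the height of a tree is the largest height of its edges. Let $T_n$ be the fully-sorted tree defined inductively as follows: $T_0$ is a single edge whose end has label $0$; for $n \ge 1$, with $m$ the largest integer such that $2^m \le n$, the tree $T_n$ has a root edge to which $T_{2^m-1}$ is attached on one side and $T_{n-2^m}$, with $2^m$ added to all its labels, on the other. There is a constant $C$, independent of $n$, such that the following hold. 1. For every $n \ge 1$, the space $\mathrm{Tree}(n)$ is connected in the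 metric $d_S$ and $\operatorname{diam}_S(\mathrm{Tree}(n)) \le C \log n$. 2. For every $n \ge 2$ and every $T \in \mathrm{Tree}(n)$ there is a tree $T' \in \mathrm{Tree}(n)$ of height at most $6 \log_2 n$ with $d_S(T, T') \le C \log n$. 3. For every $n \ge 1$ and every $T \in \mathrm{Tree}(n)$ of height at most $6 \log_2 n$, $d_S(T, T_n) \le C \log n$. -/

import Mathlib

/-- Rooted binary trees drawn in the plane, with ends labeled by natural numbers.
A tree is described by its root edge: `leaf i` is a single edge (the root edge), which is at the
same time an end with label `i`; `node l r` is a root edge at whose upper (trivalent) vertex the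
root edges of `l` and of `r` are attached, as the left and the right child of the root edge. -/
inductive PlaneTree : Type
  | leaf (i : ℕ) : PlaneTree
  | node (l r : PlaneTree) : PlaneTree

namespace PlaneTree

/-- The labels of the ends, with multiplicity. -/
def labels : PlaneTree → Multiset ℕ
  | leaf i => {i}
  | node l r => labels l + labels r

/-- The height: the root edge has height `1`, its children have height `2`, and so on; the height
of the tree is the largest height of an edge. -/
def height : PlaneTree → ℕ
  | leaf _ => 1
  | node l r => 1 + max (height l) (height r)

/-- Apply a function to all labels. -/
def relabel (f : ℕ → ℕ) : PlaneTree → PlaneTree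
  | leaf i => leaf (f i)
  | node l r => node (relabel f l) (relabel f r)

/-- `Iso t t'`: there is a homeomorphism from `t` to `t'` that takes root to root and preserves
the labels (it may exchange left and right at any vertex). -/
inductive Iso : PlaneTree → PlaneTree → Prop
  | leaf (i : ℕ) : Iso (leaf i) (leaf i)
  | node {l l' r r' : PlaneTree} : Iso l l' → Iso r r' → Iso (node l r) (node l' r')
  | swap {l l' r r' : PlaneTree} : Iso l l' → Iso r r' → Iso (node l r) (node r' l')

theorem Iso.refl : ∀ t : PlaneTree, Iso t t
  | .leaf i => .leaf i
  | .node l r => .node (Iso.refl l) (Iso.refl r)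

theorem Iso.symm {t t' : PlaneTree} (h : Iso t t') : Iso t' t := by
  induction h with
  | leaf i => exact .leaf i
  | node _ _ h₁ h₂ => exact .node h₁ h₂
  | swap _ _ h₁ h₂ => exact .swap h₂ h₁

theorem Iso.trans {t t' t'' : PlaneTree} (h : Iso t t') (h' : Iso t' t'') : Iso t t'' := by
  induction h generalizing t'' with
  | leaf i => exact h'
  | node _ _ h₁ h₂ =>
    cases h' with
    | node a b => exact .node (h₁ a) (h₂ b)
    | swap a b => exact .swap (h₁ a) (h₂ b)
  | swap _ _ h₁ h₂ =>
    cases h' with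
    | node a b => exact .swap (h₁ b) (h₂ a)
    | swap a b => exact .node (h₁ b) (h₂ a)

theorem Iso.labels_eq {t t' : PlaneTree} (h : Iso t t') : t.labels = t'.labels := by
  induction h with
  | leaf i => rfl
  | node _ _ h₁ h₂ => simp [labels, h₁, h₂]
  | swap _ _ h₁ h₂ => simp [labels, h₁, h₂, add_comm]

theorem Iso.height_eq {t t' : PlaneTree} (h : Iso t t') : t.height = t'.height := by
  induction h with
  | leaf i => rfl
  | node _ _ h₁ h₂ => simp [height, h₁, h₂]
  | swap _ _ h₁ h₂ => simp [height, h₁, h₂, max_comm]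

/-- When the labels are distinct, an edge `e` is determined by the labels of the ends of the
subtree `T_e` rooted at `e`, and we name edges by these collections of labels.
`IsParent t P A`: in `t` there is an edge named `P` with a child edge named `A`. -/
inductive IsParent : PlaneTree → Multiset ℕ → Multiset ℕ → Prop
  | left (l r : PlaneTree) : IsParent (node l r) (labels l + labels r) (labels l)
  | right (l r : PlaneTree) : IsParent (node l r) (labels l + labels r) (labels r)
  | inl {l : PlaneTree} (r : PlaneTree) {P A : Multiset ℕ} :
      IsParent l P A → IsParent (node l r) P A
  | inr (l : PlaneTree) {r : PlaneTree} {P A : Multiset ℕ} :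
      IsParent r P A → IsParent (node l r) P A

theorem IsParent.of_iso {t t' : PlaneTree} (h : Iso t t') {P A : Multiset ℕ}
    (hp : IsParent t P A) : IsParent t' P A := by
  induction h with
  | leaf i => exact hp
  | node a b h₁ h₂ =>
    cases hp with
    | left => rw [a.labels_eq, b.labels_eq]; exact .left _ _
    | right => rw [a.labels_eq, b.labels_eq]; exact .right _ _
    | inl _ h => exact .inl _ (h₁ h)
    | inr _ h => exact .inr _ (h₂ h)
  | swap a b h₁ h₂ =>
    cases hp with
    | left => rw [a.labels_eq, b.labels_eq, add_comm]; exact .right _ _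
    | right => rw [a.labels_eq, b.labels_eq, add_comm]; exact .left _ _
    | inl _ h => exact .inr _ (h₁ h)
    | inr _ h => exact .inl _ (h₂ h)

/-- `Reopen A t t'`: the plane tree `t'` arises from `t` by collapsing the interior edge named `A`
and reopening it in a different direction. In `node (node x y) z` the collapsed edge is the left
child of the root edge; its collapse leaves a vertex where `x`, `y`, `z` and the root edge meet,
and the new edge carries `x` and `z`. All other cases, in particular the second way to reopen,
are the same up to exchanging left and right, i.e. up to `Iso`. -/
inductive Reopen : Multiset ℕ → PlaneTree → PlaneTree → Prop
  | here (x y z : PlaneTree) :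
      Reopen (labels x + labels y) (node (node x y) z) (node (node x z) y)
  | inl {A : Multiset ℕ} {l l' : PlaneTree} (r : PlaneTree) :
      Reopen A l l' → Reopen A (node l r) (node l' r)
  | inr {A : Multiset ℕ} (l : PlaneTree) {r r' : PlaneTree} :
      Reopen A r r' → Reopen A (node l r) (node l r')

/-- The binary-expansion tree with labels `0, …, n`, drawn in the plane: for `n ≥ 1`, with `2 ^ m`
the largest power of two such that `2 ^ m ≤ n`, its left child subtree is the tree for `2 ^ m - 1`
and its right child subtree is the tree for `n - 2 ^ m` with `2 ^ m` added to all labels. -/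
def binaryExpansion : ℕ → PlaneTree
  | 0 => leaf 0
  | n + 1 =>
    node (binaryExpansion (2 ^ Nat.log 2 (n + 1) - 1))
      ((binaryExpansion (n + 1 - 2 ^ Nat.log 2 (n + 1))).relabel
        (fun i => 2 ^ Nat.log 2 (n + 1) + i))
termination_by n => n
decreasing_by
  · have := Nat.pow_log_le_self 2 (Nat.succ_ne_zero n)
    have := Nat.pow_pos (n := Nat.log 2 (n + 1)) (show 0 < 2 by norm_num)
    simp only [Nat.succ_eq_add_one] at *
    omega
  · have := Nat.pow_pos (n := Nat.log 2 (n + 1)) (show 0 < 2 by norm_num)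
    omega

theorem labels_relabel (f : ℕ → ℕ) (t : PlaneTree) :
    (t.relabel f).labels = t.labels.map f := by
  induction t with
  | leaf i => simp [relabel, labels]
  | node l r h₁ h₂ => simp [relabel, labels, h₁, h₂]

theorem labels_binaryExpansion (n : ℕ) :
    (binaryExpansion n).labels = Multiset.range (n + 1) := by
  induction n using Nat.strong_induction_on with
  | _ n ih =>
    cases n with
    | zero => simp [binaryExpansion, labels]
    | succ n =>
      have h₁ : 2 ^ Nat.log 2 (n + 1) ≤ n + 1 := Nat.pow_log_le_self 2 (Nat.succ_ne_zero n)
      have h₂ : 0 < 2 ^ Nat.log 2 (n + 1) := Nat.pow_pos (show 0 < 2 by norm_num)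
      rw [binaryExpansion, labels, labels_relabel, ih _ (by omega), ih _ (by omega)]
      have e₁ : 2 ^ Nat.log 2 (n + 1) - 1 + 1 = 2 ^ Nat.log 2 (n + 1) := by omega
      have e₂ : n + 1 + 1
          = 2 ^ Nat.log 2 (n + 1) + (n + 1 - 2 ^ Nat.log 2 (n + 1) + 1) := by omega
      rw [e₁]
      conv_rhs => rw [e₂, Multiset.range_add]

end PlaneTree

/-- Plane trees whose ends carry each of the labels `0, …, n` exactly once. -/
abbrev PlaneLabeledTree (n : ℕ) : Type :=
  {t : PlaneTree // t.labels = Multiset.range (n + 1)}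

/-- Two such trees are identified if there is a homeomorphism between them that takes root to root
and preserves the labels. -/
instance PlaneLabeledTree.setoid (n : ℕ) : Setoid (PlaneLabeledTree n) where
  r s t := PlaneTree.Iso s.1 t.1
  iseqv := ⟨fun t => .refl t.1, fun h => h.symm, fun h h' => h.trans h'⟩

/-- The space of labeled trees of complexity `n`: rooted binary trees whose ends are labeled
`0, …, n`. -/
def LabeledTree (n : ℕ) : Type := Quotient (PlaneLabeledTree.setoid n)

namespace LabeledTree

variable {n : ℕ}

/-- The height of a labeled tree. -/
def height (T : LabeledTree n) : ℕ :=
  Quotient.lift (fun t : PlaneLabeledTree n => t.1.height) (fun _ _ h => PlaneTree.Iso.height_eq h) T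

/-- In `T` there is an edge named `P` with a child edge named `A`; an edge `e` is named by the
labels of the ends of the subtree `T_e`. -/
def IsParent (T : LabeledTree n) (P A : Multiset ℕ) : Prop :=
  Quotient.lift (fun t : PlaneLabeledTree n => t.1.IsParent P A)
    (fun _ _ h => propext ⟨fun hp => hp.of_iso h, fun hp => hp.of_iso (PlaneTree.Iso.symm h)⟩) T

/-- `A` is an interior edge of `T`: both its vertices are trivalent, that is, it has a parent edge
(it is not the root edge) and it has child edges (it is not an end). -/
def IsInteriorEdge (T : LabeledTree n) (A : Multiset ℕ) : Prop :=
  (∃ P, T.IsParent P A) ∧ (∃ B, T.IsParent A B)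

/-- The two vertices of an interior edge `A` of `T`. A trivalent vertex is named by the edge below
it, i.e. the one of its three edges that is the parent of the other two: the upper vertex of `A`
is named by `A`, the lower vertex of `A` is named by the parent of `A`. -/
def vertices (T : LabeledTree n) (A : Multiset ℕ) : Set (Multiset ℕ) :=
  {v | v = A ∨ T.IsParent v A}

/-- Two interior edges are disjoint if they do not share any vertices. -/
def EdgesDisjoint (T : LabeledTree n) (A B : Multiset ℕ) : Prop :=
  Disjoint (T.vertices A) (T.vertices B)

/-- `T'` is obtained from `T` by a Whitehead move on the interior edge `A` of `T`. -/
def WhiteheadMove (A : Multiset ℕ) (T T' : LabeledTree n) : Prop :=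
  ∃ t t' : PlaneLabeledTree n, T = Quotient.mk _ t ∧ T' = Quotient.mk _ t' ∧
    PlaneTree.Reopen A t.1 t'.1

/-- `T'` is obtained from `T` by successive Whitehead moves on the edges named in a list. -/
def WhiteheadMoves : List (Multiset ℕ) → LabeledTree n → LabeledTree n → Prop
  | [], T, T' => T = T'
  | A :: E, T, T' => ∃ S : LabeledTree n, WhiteheadMove A T S ∧ WhiteheadMoves E S T'

/-- `T'` is obtained from `T` by a simultaneous Whitehead move: a composition of Whitehead moves
on an arbitrary number of pairwise disjoint interior edges of `T`. A Whitehead move on an edge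
leaves the labels of the subtree `T_e` unchanged for every other edge `e`, so the edges of `T`
that are still to be moved keep their names. -/
def SimultaneousMove (T T' : LabeledTree n) : Prop :=
  ∃ E : List (Multiset ℕ), (∀ A ∈ E, T.IsInteriorEdge A) ∧ E.Pairwise T.EdgesDisjoint ∧
    WhiteheadMoves E T T'

/-- The graph on the space of labeled trees in which two distinct trees are adjacent if they
differ by a simultaneous Whitehead move. Its graph distance is the metric `d_S`. -/
def simultaneousGraph (n : ℕ) : SimpleGraph (LabeledTree n) :=
  SimpleGraph.fromRel SimultaneousMove

/-- The fully-sorted tree `T_n`. -/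
def fullySorted (n : ℕ) : LabeledTree n :=
  Quotient.mk _ ⟨PlaneTree.binaryExpansion n, PlaneTree.labels_binaryExpansion n⟩

end LabeledTree

/-! All three parts follow from one estimate: every tree is `O(log n)` simultaneous moves away from
`fullySorted n`. The second part then takes the fully-sorted tree itself as `T'`.

Balancing (`Cluster.contracts`) is parallel tree contraction. The tree is viewed as a binary tree of
clusters. One parallel move lets the number of clusters drop by a factor `3/4` unless only one is
left, while the heights of clusters grow by at most one. Hence `O(log n)` moves reach logarithmic
height.

Sorting (`exists_steps_trie`) is a pipelined merge sort. A vertex merges the binary tries of its two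
subtrees by the exchange `(l₀ l₁)(r₀ r₁) → (l₀ r₀)(l₁ r₁)`, which costs three parallel moves, and
then continues one bit further down in both halves at once. Its parent can start one time unit after
it, so the total time is height plus number of bits, not their product. The final trie depends only
on the set of labels. A balanced tree and the fully-sorted tree, both of logarithmic height,
therefore reach the same trie, and the triangle inequality finishes.

Moves are handled as a recursive relation on plane trees; `ParallelMove.exists_reopens` translates
it into lists of moves on disjoint edges. -/

namespace PlaneTree

/-! ### Parallel Whitehead moves on plane trees -/

/-- `t'` arises from `t` by Whitehead moves on pairwise disjoint interior edges. -/
inductive ParallelMove : PlaneTree → PlaneTree → Prop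
  | leaf (i : ℕ) : ParallelMove (leaf i) (leaf i)
  | node {l l' r r' : PlaneTree} :
      ParallelMove l l' → ParallelMove r r' → ParallelMove (node l r) (node l' r')
  | whitehead {x x' y y' z z' : PlaneTree} :
      ParallelMove x x' → ParallelMove y y' → ParallelMove z z' →
      ParallelMove (node (node x y) z) (node (node x' z') y')

theorem ParallelMove.refl : ∀ t : PlaneTree, ParallelMove t t
  | .leaf i => .leaf i
  | .node l r => .node (.refl l) (.refl r)

theorem ParallelMove.labels_eq {t t' : PlaneTree} (h : ParallelMove t t') :
    t.labels = t'.labels := by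
  induction h with
  | leaf i => rfl
  | node _ _ h₁ h₂ => simp [labels, h₁, h₂]
  | whitehead _ _ _ h₁ h₂ h₃ => simp only [labels, h₁, h₂, h₃]; abel

theorem Reopen.labels_eq {A : Multiset ℕ} {t t' : PlaneTree} (h : Reopen A t t') :
    t.labels = t'.labels := by
  induction h with
  | here x y z => simp only [labels]; abel
  | inl r _ h => simp [labels, h]
  | inr l _ h => simp [labels, h]

/-! ### Realizing a parallel move by Whitehead moves on disjoint edges. -/

/-- `t'` is obtained from `t` by reopening the edges named in a list, one after the other. -/
def Reopens : List (Multiset ℕ) → PlaneTree → PlaneTree → Prop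
  | [], t, t' => t = t'
  | A :: E, t, t' => ∃ s, Reopen A t s ∧ Reopens E s t'

theorem Reopens.append {E F : List (Multiset ℕ)} {t s t' : PlaneTree} (h : Reopens E t s)
    (h' : Reopens F s t') : Reopens (E ++ F) t t' := by
  induction E generalizing t with
  | nil => cases h; exact h'
  | cons A E ih => obtain ⟨u, hu, h⟩ := h; exact ⟨u, hu, ih h⟩

theorem Reopens.inl {E : List (Multiset ℕ)} {l l' : PlaneTree} (r : PlaneTree)
    (h : Reopens E l l') : Reopens E (.node l r) (.node l' r) := by
  induction E generalizing l with
  | nil => cases h; rfl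
  | cons A E ih => obtain ⟨u, hu, h⟩ := h; exact ⟨_, .inl r hu, ih h⟩

theorem Reopens.inr {E : List (Multiset ℕ)} (l : PlaneTree) {r r' : PlaneTree}
    (h : Reopens E r r') : Reopens E (.node l r) (.node l r') := by
  induction E generalizing r with
  | nil => cases h; rfl
  | cons A E ih => obtain ⟨u, hu, h⟩ := h; exact ⟨_, .inr l hu, ih h⟩

theorem labels_ne_zero (t : PlaneTree) : t.labels ≠ 0 := by
  induction t with
  | leaf i => simp [labels]
  | node l r h₁ _ => simp [labels, h₁]

theorem labels_left_lt (l r : PlaneTree) : l.labels < l.labels + r.labels :=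
  lt_add_of_pos_right _ (pos_iff_ne_zero.2 r.labels_ne_zero)

theorem labels_right_lt (l r : PlaneTree) : r.labels < l.labels + r.labels :=
  lt_add_of_pos_left _ (pos_iff_ne_zero.2 l.labels_ne_zero)

theorem IsParent.ne_zero {t : PlaneTree} {P A : Multiset ℕ} (h : IsParent t P A) : A ≠ 0 := by
  induction h with
  | left l r => exact l.labels_ne_zero
  | right l r => exact r.labels_ne_zero
  | inl _ _ h => exact h
  | inr _ _ h => exact h

theorem IsParent.lt {t : PlaneTree} {P A : Multiset ℕ} (h : IsParent t P A) : A < P := by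
  induction h with
  | left l r => exact labels_left_lt l r
  | right l r => exact labels_right_lt l r
  | inl _ _ h => exact h
  | inr _ _ h => exact h

theorem IsParent.le {t : PlaneTree} {P A : Multiset ℕ} (h : IsParent t P A) : P ≤ t.labels := by
  induction h with
  | left l r => exact le_rfl
  | right l r => exact le_rfl
  | inl r _ h => exact h.trans (labels_left_lt _ r).le
  | inr l _ h => exact h.trans (labels_right_lt l _).le

/-- `A` names an edge that has a parent and a child. -/
def Interior (t : PlaneTree) (A : Multiset ℕ) : Prop :=
  (∃ P, t.IsParent P A) ∧ ∃ B, t.IsParent A B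

/-- The names of the two vertices of the edge named `A`. -/
def vertexNames (t : PlaneTree) (A : Multiset ℕ) : Set (Multiset ℕ) :=
  {v | v = A ∨ t.IsParent v A}

theorem Interior.inl {l : PlaneTree} (r : PlaneTree) {A : Multiset ℕ} (h : l.Interior A) :
    (node l r).Interior A :=
  ⟨h.1.imp fun _ => .inl r, h.2.imp fun _ => .inl r⟩

theorem Interior.inr (l : PlaneTree) {r : PlaneTree} {A : Multiset ℕ} (h : r.Interior A) :
    (node l r).Interior A :=
  ⟨h.1.imp fun _ => .inr l, h.2.imp fun _ => .inr l⟩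

theorem eq_zero_of_le_labels {l r : PlaneTree} (hn : (node l r).labels.Nodup) {A : Multiset ℕ}
    (hl : A ≤ l.labels) (hr : A ≤ r.labels) : A = 0 :=
  le_bot_iff.1 ((Multiset.nodup_add.1 hn).2.2 hl hr)

/-- An edge with a parent inside `l` has strictly fewer labels than `l`, so it is not the root edge
of `l` and gains no parent at the new root vertex. Distinctness of labels excludes parents in `r`.
-/
theorem Interior.vertexNames_inl {l r : PlaneTree} (hn : (node l r).labels.Nodup)
    {A : Multiset ℕ} (h : l.Interior A) : (node l r).vertexNames A ⊆ l.vertexNames A := by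
  rintro v (rfl | hv)
  · exact .inl rfl
  obtain ⟨P, hP⟩ := h.1
  have hA := hP.lt.trans_le hP.le
  cases hv with
  | left => exact absurd hA (lt_irrefl _)
  | right => exact absurd (eq_zero_of_le_labels hn hA.le le_rfl) hP.ne_zero
  | inl _ hv => exact .inr hv
  | inr _ hv => exact absurd (eq_zero_of_le_labels hn hA.le (hv.lt.le.trans hv.le)) hP.ne_zero

theorem Interior.vertexNames_inr {l r : PlaneTree} (hn : (node l r).labels.Nodup)
    {A : Multiset ℕ} (h : r.Interior A) : (node l r).vertexNames A ⊆ r.vertexNames A := by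
  rintro v (rfl | hv)
  · exact .inl rfl
  obtain ⟨P, hP⟩ := h.1
  have hA := hP.lt.trans_le hP.le
  cases hv with
  | right => exact absurd hA (lt_irrefl _)
  | left => exact absurd (eq_zero_of_le_labels hn le_rfl hA.le) hP.ne_zero
  | inr _ hv => exact .inr hv
  | inl _ hv => exact absurd (eq_zero_of_le_labels hn (hv.lt.le.trans hv.le) hA.le) hP.ne_zero

theorem Interior.le_labels {t : PlaneTree} {A v : Multiset ℕ} (h : t.Interior A)
    (hv : v ∈ t.vertexNames A) : v ≤ t.labels := by
  obtain ⟨P, hP⟩ := h.1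
  obtain rfl | hv := hv
  · exact hP.lt.le.trans hP.le
  · exact hv.le

theorem Interior.le_vertex {t : PlaneTree} {A v : Multiset ℕ} (hv : v ∈ t.vertexNames A) :
    A ≤ v := by
  obtain rfl | hv := hv
  · exact le_rfl
  · exact hv.lt.le

theorem Interior.vertex_ne_zero {t : PlaneTree} {A v : Multiset ℕ} (h : t.Interior A)
    (hv : v ∈ t.vertexNames A) : v ≠ 0 := by
  obtain ⟨P, hP⟩ := h.1
  rintro rfl
  exact hP.ne_zero (le_bot_iff.1 (Interior.le_vertex hv))

/-- A list of pairwise disjoint interior edges. -/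
def DisjointInterior (t : PlaneTree) (E : List (Multiset ℕ)) : Prop :=
  (∀ A ∈ E, t.Interior A) ∧ E.Pairwise fun A B => Disjoint (t.vertexNames A) (t.vertexNames B)

theorem DisjointInterior.append {l r : PlaneTree} (hn : (node l r).labels.Nodup)
    {E F : List (Multiset ℕ)} (hE : l.DisjointInterior E) (hF : r.DisjointInterior F) :
    (node l r).DisjointInterior (E ++ F) := by
  refine ⟨fun A hA => ?_, List.pairwise_append.2 ⟨?_, ?_, fun A hA B hB => ?_⟩⟩
  · rcases List.mem_append.1 hA with hA | hA
    · exact (hE.1 A hA).inl r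
    · exact (hF.1 A hA).inr l
  · exact hE.2.imp_of_mem fun ha hb h =>
      h.mono ((hE.1 _ ha).vertexNames_inl hn) ((hE.1 _ hb).vertexNames_inl hn)
  · exact hF.2.imp_of_mem fun ha hb h =>
      h.mono ((hF.1 _ ha).vertexNames_inr hn) ((hF.1 _ hb).vertexNames_inr hn)
  · refine Set.disjoint_left.2 fun v hv hv' => ?_
    have h₁ := (hE.1 A hA).vertexNames_inl hn hv
    have h₂ := (hF.1 B hB).vertexNames_inr hn hv'
    exact (hE.1 A hA).vertex_ne_zero h₁
      (eq_zero_of_le_labels hn ((hE.1 A hA).le_labels h₁) ((hF.1 B hB).le_labels h₂))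

/-- The moves inside the pieces come first and the top edge last. Inner moves preserve the labels of
`x` and `y`, so the top edge keeps its name. It is disjoint from the inner edges because its vertex
names contain all labels of `node x y`, whereas theirs lie within the labels of `x`, `y` or `z`
alone. -/
theorem ParallelMove.exists_reopens {t t' : PlaneTree} (h : ParallelMove t t')
    (hn : t.labels.Nodup) : ∃ E, t.DisjointInterior E ∧ Reopens E t t' := by
  induction h with
  | leaf i => exact ⟨[], ⟨by simp, .nil⟩, rfl⟩
  | node _ _ h₁ h₂ =>
    have hn' := Multiset.nodup_add.1 hn
    obtain ⟨E, hE, hE'⟩ := h₁ hn'.1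
    obtain ⟨F, hF, hF'⟩ := h₂ hn'.2.1
    exact ⟨E ++ F, hE.append hn hF, (hE'.inl _).append (hF'.inr _)⟩
  | @whitehead x x' y y' z z' hx hy hz h₁ h₂ h₃ =>
    have hn₁ := Multiset.nodup_add.1 hn
    have hn₂ := Multiset.nodup_add.1 hn₁.1
    obtain ⟨E, hE, hE'⟩ := h₁ hn₂.1
    obtain ⟨F, hF, hF'⟩ := h₂ hn₂.2.1
    obtain ⟨G, hG, hG'⟩ := h₃ hn₁.2.1
    have hEF := hE.append hn₁.1 hF
    have hEFG := hEF.append hn hG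
    refine ⟨((E ++ F) ++ G) ++ [x.labels + y.labels], ⟨fun A hA => ?_, ?_⟩,
      ((((hE'.inl _).append (hF'.inr _)).inl _).append (hG'.inr _)).append
        ⟨_, by rw [hx.labels_eq, hy.labels_eq]; exact .here _ _ _, rfl⟩⟩
    · rcases List.mem_append.1 hA with hA | hA
      · exact hEFG.1 A hA
      · obtain rfl := List.mem_singleton.1 hA
        exact ⟨⟨_, .left (.node x y) z⟩, ⟨_, .inl z (.left x y)⟩⟩
    · refine List.pairwise_append.2 ⟨hEFG.2, List.pairwise_singleton _ _, fun A hA B hB => ?_⟩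
      obtain rfl := List.mem_singleton.1 hB
      refine Set.disjoint_left.2 fun v hv hv' => ?_
      have hle := Interior.le_vertex hv'
      rcases List.mem_append.1 hA with hA | hA
      · have hv := (hEF.1 A hA).vertexNames_inl hn hv
        rcases List.mem_append.1 hA with hA | hA
        · have hA := hE.1 A hA
          exact absurd (hle.trans (hA.le_labels (hA.vertexNames_inl hn₁.1 hv)))
            (labels_left_lt x y).not_ge
        · have hA := hF.1 A hA
          exact absurd (hle.trans (hA.le_labels (hA.vertexNames_inr hn₁.1 hv)))
            (labels_right_lt x y).not_ge
      · have hA := hG.1 A hA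
        exact (PlaneTree.node x y).labels_ne_zero (eq_zero_of_le_labels hn le_rfl
          (hle.trans (hA.le_labels (hA.vertexNames_inr hn hv))))

/-! ### Sequences of parallel moves up to homeomorphism. -/

/-- A parallel move up to homeomorphism. -/
def OneStep (t t' : PlaneTree) : Prop :=
  ∃ s s', Iso t s ∧ ParallelMove s s' ∧ Iso s' t'

theorem OneStep.refl (t : PlaneTree) : OneStep t t :=
  ⟨t, t, .refl t, .refl t, .refl t⟩

theorem OneStep.iso_left {s t t' : PlaneTree} (h : Iso s t) (h' : OneStep t t') :
    OneStep s t' := by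
  obtain ⟨u, v, h₁, h₂, h₃⟩ := h'
  exact ⟨u, v, h.trans h₁, h₂, h₃⟩

theorem OneStep.iso_right {s t t' : PlaneTree} (h : OneStep s t) (h' : Iso t t') :
    OneStep s t' := by
  obtain ⟨u, v, h₁, h₂, h₃⟩ := h
  exact ⟨u, v, h₁, h₂, h₃.trans h'⟩

theorem OneStep.node {l l' r r' : PlaneTree} (hl : OneStep l l') (hr : OneStep r r') :
    OneStep (.node l r) (.node l' r') := by
  obtain ⟨a, a', h₁, h₂, h₃⟩ := hl
  obtain ⟨b, b', k₁, k₂, k₃⟩ := hr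
  exact ⟨_, _, .node h₁ k₁, .node h₂ k₂, .node h₃ k₃⟩

theorem OneStep.whitehead {x x' y y' z z' : PlaneTree} (hx : OneStep x x') (hy : OneStep y y')
    (hz : OneStep z z') :
    OneStep (.node (.node x y) z) (.node (.node x' z') y') := by
  obtain ⟨a, a', h₁, h₂, h₃⟩ := hx
  obtain ⟨b, b', k₁, k₂, k₃⟩ := hy
  obtain ⟨c, c', m₁, m₂, m₃⟩ := hz
  exact ⟨_, _, .node (.node h₁ k₁) m₁, .whitehead h₂ k₂ m₂, .node (.node h₃ m₃) k₃⟩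

theorem OneStep.labels_eq {t t' : PlaneTree} (h : OneStep t t') : t.labels = t'.labels := by
  obtain ⟨a, b, h₁, h₂, h₃⟩ := h
  rw [h₁.labels_eq, h₂.labels_eq, h₃.labels_eq]

/-- `k` parallel moves, one after the other. -/
def Steps : ℕ → PlaneTree → PlaneTree → Prop
  | 0, t, t' => Iso t t'
  | k + 1, t, t' => ∃ s, OneStep t s ∧ Steps k s t'

theorem Steps.refl (k : ℕ) (t : PlaneTree) : Steps k t t := by
  induction k with
  | zero => exact Iso.refl t
  | succ k ih => exact ⟨t, .refl t, ih⟩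

theorem Steps.iso_left {k : ℕ} {s t t' : PlaneTree} (h : Iso s t) (h' : Steps k t t') :
    Steps k s t' := by
  cases k with
  | zero => exact h.trans h'
  | succ k => obtain ⟨u, h₁, h₂⟩ := h'; exact ⟨u, h₁.iso_left h, h₂⟩

theorem Steps.iso_right {k : ℕ} {s t t' : PlaneTree} (h : Steps k s t) (h' : Iso t t') :
    Steps k s t' := by
  induction k generalizing s with
  | zero => exact Iso.trans h h'
  | succ k ih => obtain ⟨u, h₁, h₂⟩ := h; exact ⟨u, h₁, ih h₂⟩

theorem Steps.trans {j k : ℕ} {s t t' : PlaneTree} (h : Steps j s t) (h' : Steps k t t') :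
    Steps (k + j) s t' := by
  induction j generalizing s with
  | zero => exact h'.iso_left h
  | succ j ih => obtain ⟨u, h₁, h₂⟩ := h; exact ⟨u, h₁, ih h₂⟩

theorem Steps.node {k : ℕ} {l l' r r' : PlaneTree} (hl : Steps k l l') (hr : Steps k r r') :
    Steps k (.node l r) (.node l' r') := by
  induction k generalizing l r with
  | zero => exact Iso.node hl hr
  | succ k ih =>
    obtain ⟨u, h₁, h₂⟩ := hl
    obtain ⟨v, k₁, k₂⟩ := hr
    exact ⟨_, h₁.node k₁, ih h₂ k₂⟩

/-- The first step carries the move at the top; the later ones only act inside the three pieces. -/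
theorem Steps.whitehead {k : ℕ} {x x' y y' z z' : PlaneTree} (hx : Steps (k + 1) x x')
    (hy : Steps (k + 1) y y') (hz : Steps (k + 1) z z') :
    Steps (k + 1) (.node (.node x y) z) (.node (.node x' z') y') := by
  obtain ⟨a, h₁, h₂⟩ := hx
  obtain ⟨b, k₁, k₂⟩ := hy
  obtain ⟨c, m₁, m₂⟩ := hz
  exact ⟨_, h₁.whitehead k₁ m₁, (h₂.node m₂).node k₂⟩

theorem Steps.labels_eq {k : ℕ} {t t' : PlaneTree} (h : Steps k t t') :
    t.labels = t'.labels := by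
  induction k generalizing t with
  | zero => exact Iso.labels_eq h
  | succ k ih => obtain ⟨u, h₁, h₂⟩ := h; rw [h₁.labels_eq, ih h₂]

theorem Iso.swap_node (l r : PlaneTree) : Iso (.node l r) (.node r l) :=
  .swap (.refl l) (.refl r)

/-- The route is `(ab)(cd) → (a(cd))b → ((ca)d)b → (db)(ca)`, and the four pieces evolve meanwhile.
-/
theorem Steps.exchange {a a' b b' c c' d d' : PlaneTree} (ha : Steps 3 a a')
    (hb : Steps 3 b b') (hc : Steps 3 c c') (hd : Steps 3 d d') :
    Steps 3 (.node (.node a b) (.node c d)) (.node (.node a' c') (.node b' d')) := by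
  obtain ⟨a₁, ha₁, a₂, ha₂, a₃, ha₃, ia⟩ := ha
  obtain ⟨b₁, hb₁, b₂, hb₂, b₃, hb₃, ib⟩ := hb
  obtain ⟨c₁, hc₁, c₂, hc₂, c₃, hc₃, ic⟩ := hc
  obtain ⟨d₁, hd₁, d₂, hd₂, d₃, hd₃, id⟩ := hd
  refine ⟨_, ha₁.whitehead hb₁ (hc₁.node hd₁), _,
    ((hc₂.whitehead hd₂ ha₂).iso_left (.swap_node _ _)).node hb₂, _,
    (hd₃.whitehead (hc₃.node ha₃) hb₃).iso_left (.node (.swap_node _ _) (.refl _)), ?_⟩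
  exact .swap (.swap id ib) (.swap ic ia)

/-! ### Sorting by merging binary tries

At time `time`, the vertices of a tree of height at most `time` have been merged into the top of a
binary trie; merging proceeds from the top of the trie to its bottom, one bit per time unit, so
that the vertex below can follow with a delay of one time unit. -/

/-- Attach two possibly empty trees to a common root edge. -/
def join : Option PlaneTree → Option PlaneTree → Option PlaneTree
  | some a, some b => some (node a b)
  | some a, none => some a
  | none, o => o

@[simp] theorem join_none (o : Option PlaneTree) : join o none = o := by cases o <;> rfl

@[simp] theorem none_join (o : Option PlaneTree) : join none o = o := rfl

@[simp] theorem join_some (a b : PlaneTree) : join (some a) (some b) = some (node a b) := rfl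

theorem join_rel {k : ℕ} {a a' b b' : Option PlaneTree} (ha : Option.Rel (Steps k) a a')
    (hb : Option.Rel (Steps k) b b') : Option.Rel (Steps k) (join a b) (join a' b') := by
  cases ha with
  | none => exact hb
  | some ha =>
    cases hb with
    | none => exact .some ha
    | some hb => exact .some (ha.node hb)

/-- With at most three pieces present, at most one Whitehead move regroups them; with all four,
`Steps.exchange` applies. -/
theorem join_exchange {a a' b b' c c' d d' : Option PlaneTree}
    (ha : Option.Rel (Steps 3) a a') (hb : Option.Rel (Steps 3) b b')
    (hc : Option.Rel (Steps 3) c c') (hd : Option.Rel (Steps 3) d d') :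
    Option.Rel (Steps 3) (join (join a b) (join c d)) (join (join a' c') (join b' d')) := by
  cases ha with
  | none =>
    cases hb with
    | none => simpa using join_rel hc hd
    | some hb =>
      cases hc with
      | none => simpa using join_rel (.some hb) hd
      | some hc =>
        cases hd with
        | none => exact .some ((hb.node hc).iso_right (.swap_node _ _))
        | some hd =>
          exact .some (((hd.whitehead hc hb).iso_left
            (.swap (.refl _) (.swap_node _ _))).iso_right (.swap (.swap_node _ _) (.refl _)))
  | some ha =>
    cases hb with
    | none =>
      cases hc with
      | none => simpa using join_rel (.some ha) hd
      | some hc =>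
        cases hd with
        | none => exact .some (ha.node hc)
        | some hd =>
          exact .some (((hc.whitehead hd ha).iso_left (.swap_node _ _)).iso_right
            (.node (.swap_node _ _) (.refl _)))
    | some hb =>
      cases hc with
      | none =>
        cases hd with
        | none => exact .some (ha.node hb)
        | some hd =>
          exact .some (((hb.whitehead ha hd).iso_left
            (.node (.swap_node _ _) (.refl _))).iso_right (.swap_node _ _))
      | some hc =>
        cases hd with
        | none => exact .some (ha.whitehead hb hc)
        | some hd => exact .some (ha.exchange hb hc hd)

/-- The state at time `time` of the part of `t` that carries the labels `i` with
`i / 2 ^ j = w`, when the merging starts with the given delay. -/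
def stage (time : ℕ) : (t : PlaneTree) → (j delay w : ℕ) → Option PlaneTree
  | leaf i, j, _, w => if i / 2 ^ j = w then some (leaf i) else none
  | node l r, 0, s, w => join (stage time l 0 s w) (stage time r 0 s w)
  | node l r, j + 1, s, w =>
    if (node l r).height + s ≤ time then
      join (stage time (node l r) j (s + 1) (2 * w)) (stage time (node l r) j (s + 1) (2 * w + 1))
    else join (stage time l (j + 1) s w) (stage time r (j + 1) s w)
termination_by t j => (sizeOf t, j)

theorem one_le_height (t : PlaneTree) : 1 ≤ t.height := by
  cases t <;> simp [height]

theorem div_two_pow_succ_eq_iff (i j w : ℕ) :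
    i / 2 ^ (j + 1) = w ↔ i / 2 ^ j = 2 * w ∨ i / 2 ^ j = 2 * w + 1 := by
  rw [pow_succ, ← Nat.div_div_eq_div_mul]; omega

/-- At an end, splitting by a bit leaves one half empty, so ends count as already merged tries. -/
theorem stage_split {time : ℕ} {t : PlaneTree} {s : ℕ} (h : t.height + s ≤ time) (j w : ℕ) :
    stage time t (j + 1) s w
      = join (stage time t j (s + 1) (2 * w)) (stage time t j (s + 1) (2 * w + 1)) := by
  cases t with
  | leaf i =>
    simp only [stage, div_two_pow_succ_eq_iff]
    by_cases h₁ : i / 2 ^ j = 2 * w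
    · simp [h₁]
    · simp [h₁]
  | node l r => rw [stage, if_pos h]

theorem stage_join {time : ℕ} {l r : PlaneTree} {s : ℕ} (h : time < (node l r).height + s)
    (j w : ℕ) :
    stage time (node l r) j s w = join (stage time l j s w) (stage time r j s w) := by
  cases j with
  | zero => rw [stage]
  | succ j => rw [stage, if_neg h.not_ge]

/-- A vertex of height `h` changes at its top bit only when the time becomes `h + s`. Before that,
the change happens in its two subtrees; afterwards, in the two halves of its trie, whence the inner
induction on `j`. -/
theorem stage_succ (time : ℕ) (t : PlaneTree) (j s w : ℕ) :
    Option.Rel (Steps 3) (stage time t j s w) (stage (time + 1) t j s w) := by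
  induction t generalizing j s w with
  | leaf i =>
    simp only [stage]
    split_ifs
    · exact .some (.refl _ _)
    · exact .none
  | node l r hl hr =>
    induction j generalizing s w with
    | zero => simp only [stage]; exact join_rel (hl _ _ _) (hr _ _ _)
    | succ j ih =>
      rcases lt_trichotomy (time + 1) ((node l r).height + s) with h | h | h
      · rw [stage_join (by omega), stage_join h]
        exact join_rel (hl _ _ _) (hr _ _ _)
      · have h' := h
        simp only [height] at h'
        -- The moment of merging: both children, being lower, are already split at this bit, while
        -- the new halves, delayed by one more unit, are not yet split at the next bit. The change
        -- is exactly an exchange.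
        rw [stage_join (by omega), stage_split (t := l) (by omega), stage_split (t := r) (by omega),
          stage_split h.ge, stage_join (by omega), stage_join (by omega)]
        exact join_exchange (hl _ _ _) (hl _ _ _) (hr _ _ _) (hr _ _ _)
      · rw [stage_split (by omega), stage_split (by omega)]
        exact join_rel (ih _ _) (ih _ _)

theorem stage_zero {t : PlaneTree} {j w : ℕ} (h : ∀ i ∈ t.labels, i / 2 ^ j = w) (s : ℕ) :
    stage 0 t j s w = some t := by
  induction t with
  | leaf i => simp [stage, h i (by simp [labels])]
  | node l r hl hr =>
    rw [stage_join (by have := one_le_height (node l r); omega),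
      hl fun i hi => h i (Multiset.mem_add.2 (.inl hi)),
      hr fun i hi => h i (Multiset.mem_add.2 (.inr hi)), join_some]

/-- The binary trie on those labels `i` in `m` with `i / 2 ^ j = w`. -/
def trie (m : Multiset ℕ) : ℕ → ℕ → Option PlaneTree
  | 0, w => if w ∈ m then some (leaf w) else none
  | j + 1, w => join (trie m j (2 * w)) (trie m j (2 * w + 1))

theorem stage_zero_bits (time : ℕ) {t : PlaneTree} (hn : t.labels.Nodup) (s w : ℕ) :
    stage time t 0 s w = if w ∈ t.labels then some (leaf w) else none := by
  induction t with
  | leaf i =>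
    simp only [stage, labels, pow_zero, Nat.div_one, Multiset.mem_singleton]
    by_cases h : i = w
    · simp [h]
    · simp [h, Ne.symm h]
  | node l r hl hr =>
    have hn' := Multiset.nodup_add.1 hn
    rw [stage, hl hn'.1, hr hn'.2.1]
    simp only [labels, Multiset.mem_add]
    -- Since labels are distinct, at most one side of the join is nonempty.
    by_cases h₁ : w ∈ l.labels
    · have h₂ : w ∉ r.labels := Multiset.disjoint_left.1 hn'.2.2 h₁
      simp [h₁, h₂]
    · simp [h₁]

/-- Each of the `j` bits adds one unit of delay, so by this time every split has taken place and the
shape of `t` is forgotten. -/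
theorem stage_eq_trie {time : ℕ} {t : PlaneTree} (hn : t.labels.Nodup) {j s : ℕ}
    (h : t.height + s + j ≤ time) (w : ℕ) : stage time t j s w = trie t.labels j w := by
  induction j generalizing s w with
  | zero => rw [stage_zero_bits time hn, trie]
  | succ j ih => rw [stage_split (by omega), trie, ih (by omega), ih (by omega)]

theorem stage_steps {t : PlaneTree} {j w : ℕ} (h : ∀ i ∈ t.labels, i / 2 ^ j = w) (time : ℕ) :
    ∃ u, stage time t j 0 w = some u ∧ Steps (3 * time) t u := by
  induction time with
  | zero => exact ⟨t, stage_zero h 0, .refl 0 t⟩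
  | succ time ih =>
    obtain ⟨u, hu, hs⟩ := ih
    have := stage_succ time t j 0 w
    rw [hu] at this
    cases hv : stage (time + 1) t j 0 w with
    | none => rw [hv] at this; cases this
    | some v =>
      rw [hv] at this
      cases this with
      | some this =>
        refine ⟨v, rfl, ?_⟩
        rw [mul_add, add_comm]
        exact hs.trans this

theorem exists_steps_trie {t : PlaneTree} (hn : t.labels.Nodup) {L : ℕ}
    (h : ∀ i ∈ t.labels, i < 2 ^ L) :
    ∃ u, trie t.labels L 0 = some u ∧ Steps (3 * (t.height + L)) t u := by
  obtain ⟨u, hu, hs⟩ := stage_steps (fun i hi => Nat.div_eq_of_lt (h i hi)) (t.height + L)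
  rw [stage_eq_trie hn (by omega)] at hu
  exact ⟨u, hu, hs⟩

/-! ### Balancing by repeated contraction -/

/-- A binary tree whose leaves are trees that are already balanced. -/
inductive Cluster : Type
  | single (t : PlaneTree) : Cluster
  | node (a b : Cluster) : Cluster

namespace Cluster

/-- Forget which subtrees are leaves of the cluster tree. -/
def expand : Cluster → PlaneTree
  | single t => t
  | node a b => .node a.expand b.expand

/-- The number of leaves. -/
def size : Cluster → ℕ
  | single _ => 1
  | node a b => a.size + b.size

/-- The largest height of a leaf. -/
def leafHeight : Cluster → ℕ
  | single t => t.height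
  | node a b => max a.leafHeight b.leafHeight

/-- Every leaf is a single end. -/
def ofTree : PlaneTree → Cluster
  | .leaf i => single (.leaf i)
  | .node l r => node (ofTree l) (ofTree r)

theorem expand_ofTree (t : PlaneTree) : (ofTree t).expand = t := by
  induction t with
  | leaf i => rfl
  | node l r hl hr => simp [ofTree, expand, hl, hr]

theorem size_ofTree (t : PlaneTree) : (ofTree t).size = t.labels.card := by
  induction t with
  | leaf i => rfl
  | node l r hl hr => simp [ofTree, size, labels, hl, hr]

theorem leafHeight_ofTree (t : PlaneTree) : (ofTree t).leafHeight = 1 := by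
  induction t with
  | leaf i => rfl
  | node l r hl hr => simp [ofTree, leafHeight, hl, hr]

theorem one_le_size (c : Cluster) : 1 ≤ c.size := by
  induction c with
  | single t => exact le_rfl
  | node a b ha hb => exact ha.trans (Nat.le_add_right _ _)

/-- One parallel move contracts the tree of clusters by a definite factor. -/
def Contracts (c : Cluster) : Prop :=
  ∃ c' : Cluster, OneStep c.expand c'.expand ∧ c'.leafHeight ≤ c.leafHeight + 1 ∧
    (c.size = 1 ∧ c'.size = 1 ∨ 4 * c'.size + 1 ≤ 3 * c.size)

theorem Contracts.of_iso {c d : Cluster} (h : Contracts c) (hi : Iso d.expand c.expand)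
    (hs : d.size = c.size) (hh : d.leafHeight = c.leafHeight) : Contracts d := by
  obtain ⟨c', h₁, h₂, h₃⟩ := h
  exact ⟨c', h₁.iso_left hi, by omega, by omega⟩

theorem Contracts.swap {a b : Cluster} (h : Contracts (node a b)) : Contracts (node b a) :=
  h.of_iso (.swap_node _ _) (add_comm _ _) (max_comm _ _)

/-- The move `a(bx) → (ab)x'` fuses the clusters `a` and `b` while `x` contracts in parallel. This
handles long caterpillars, where few pairs of clusters are siblings. -/
theorem contracts_single_pair (a b : PlaneTree) {x : Cluster} (hx : Contracts x) :
    Contracts (node (single a) (node (single b) x)) := by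
  obtain ⟨x', h₁, h₂, h₃⟩ := hx
  refine ⟨node (single (.node a b)) x', ?_, ?_, ?_⟩
  · exact (((OneStep.refl b).whitehead h₁ (.refl a)).iso_left (.swap_node _ _)).iso_right
      (.node (.swap_node _ _) (.refl _))
  · simp only [leafHeight, PlaneTree.height]; omega
  · simp only [size]; omega

/-- The `+ 1` in the size bound is what makes the induction close: for a single cluster beside two
composite subtrees, the gains of the two subtrees pay for the cluster that does not shrink. -/
theorem contracts : ∀ c : Cluster, Contracts c
  | single t => ⟨single t, .refl t, Nat.le_succ _, .inl ⟨rfl, rfl⟩⟩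
  | node (single a) (single b) =>
    ⟨single (.node a b), .refl _, by simp only [leafHeight, PlaneTree.height]; omega,
      .inr (by simp [size])⟩
  | node (single a) (node (single b) x) => contracts_single_pair a b (contracts x)
  | node (single a) (node (node x y) (single b)) =>
    (contracts_single_pair a b (contracts (node x y))).of_iso (.node (.refl _) (.swap_node _ _))
      (by simp only [size]; omega) (by simp only [leafHeight]; omega)
  | node (node (single b) x) (single a) => (contracts_single_pair a b (contracts x)).swap
  | node (node (node x y) (single b)) (single a) =>
    (contracts_single_pair a b (contracts (node x y))).of_iso (.swap (.swap_node _ _) (.refl _))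
      (by simp only [size]; omega) (by simp only [leafHeight]; omega)
  | node (single a) (node (node x y) (node z w)) => by
    obtain ⟨c, h₁, h₂, h₃⟩ := contracts (node x y)
    obtain ⟨d, k₁, k₂, k₃⟩ := contracts (node z w)
    have := one_le_size x
    have := one_le_size y
    have := one_le_size z
    have := one_le_size w
    refine ⟨node (single a) (node c d), (OneStep.refl _).node (h₁.node k₁), ?_, ?_⟩
    · simp only [leafHeight] at *; omega
    · simp only [size] at *; omega
  | node (node (node x y) (node z w)) (single a) => by
    obtain ⟨c, h₁, h₂, h₃⟩ := contracts (node x y)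
    obtain ⟨d, k₁, k₂, k₃⟩ := contracts (node z w)
    have := one_le_size x
    have := one_le_size y
    have := one_le_size z
    have := one_le_size w
    refine ⟨node (node c d) (single a), (h₁.node k₁).node (.refl _), ?_, ?_⟩
    · simp only [leafHeight] at *; omega
    · simp only [size] at *; omega
  | node (node x y) (node z w) => by
    obtain ⟨c, h₁, h₂, h₃⟩ := contracts (node x y)
    obtain ⟨d, k₁, k₂, k₃⟩ := contracts (node z w)
    have := one_le_size x
    have := one_le_size y
    have := one_le_size z
    have := one_le_size w
    refine ⟨node c d, h₁.node k₁, ?_, ?_⟩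
    · simp only [leafHeight] at *; omega
    · simp only [size] at *; omega

theorem exists_steps_height_le (m : ℕ) (c : Cluster) (h : c.size ≤ 2 ^ m) :
    ∃ t, Steps (3 * m) c.expand t ∧ t.height ≤ c.leafHeight + 3 * m := by
  induction m generalizing c with
  | zero =>
    cases c with
    | single t => exact ⟨t, .refl 0 t, le_rfl⟩
    | node a b =>
      have := one_le_size a
      have := one_le_size b
      simp only [size, pow_zero] at h
      omega
  | succ m ih =>
    -- Three contractions at least halve a size above one, since `(3/4)^3 < 1/2`; size one stays
    -- one.
    obtain ⟨c₁, h₁, l₁, s₁⟩ := contracts c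
    obtain ⟨c₂, h₂, l₂, s₂⟩ := contracts c₁
    obtain ⟨c₃, h₃, l₃, s₃⟩ := contracts c₂
    have hm := Nat.one_le_two_pow (n := m)
    rw [pow_succ] at h
    obtain ⟨t, ht, ht'⟩ := ih c₃ (by omega)
    exact ⟨t, ⟨_, h₁, _, h₂, _, h₃, ht⟩, by omega⟩

end Cluster

/-! ### Height of the fully-sorted tree. -/

theorem height_relabel (f : ℕ → ℕ) (t : PlaneTree) : (t.relabel f).height = t.height := by
  induction t with
  | leaf i => rfl
  | node l r hl hr => simp [relabel, height, hl, hr]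

theorem height_binaryExpansion_le {n k : ℕ} (h : n < 2 ^ k) :
    (binaryExpansion n).height ≤ k + 1 := by
  induction n using Nat.strong_induction_on generalizing k with
  | _ n ih =>
    cases n with
    | zero => simp [binaryExpansion, height]
    | succ n =>
      have h₁ : 2 ^ Nat.log 2 (n + 1) ≤ n + 1 := Nat.pow_log_le_self 2 (Nat.succ_ne_zero n)
      have h₂ : 0 < 2 ^ Nat.log 2 (n + 1) := Nat.pow_pos (show 0 < 2 by norm_num)
      have h₃ : n + 1 < 2 ^ (Nat.log 2 (n + 1) + 1) := Nat.lt_pow_succ_log_self one_lt_two _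
      have h₄ : Nat.log 2 (n + 1) < k := (Nat.pow_lt_pow_iff_right one_lt_two).1 (h₁.trans_lt h)
      rw [pow_succ] at h₃
      rw [binaryExpansion, height, height_relabel]
      have := ih (2 ^ Nat.log 2 (n + 1) - 1) (by omega) (k := Nat.log 2 (n + 1)) (by omega)
      have := ih (n + 1 - 2 ^ Nat.log 2 (n + 1)) (by omega) (k := Nat.log 2 (n + 1)) (by omega)
      omega

end PlaneTree

/-! ### Distances between labeled trees -/

namespace LabeledTree

variable {n : ℕ}

/-- The labeled tree that a plane tree represents. -/
def mk (t : PlaneLabeledTree n) : LabeledTree n := Quotient.mk _ t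

theorem mk_surjective (T : LabeledTree n) : ∃ t, mk t = T := Quotient.exists_rep T

theorem mk_eq_mk {t t' : PlaneLabeledTree n} (h : PlaneTree.Iso t.1 t'.1) : mk t = mk t' :=
  Quotient.sound h

theorem whiteheadMoves_of_reopens {E : List (Multiset ℕ)} (t t' : PlaneLabeledTree n)
    (h : PlaneTree.Reopens E t.1 t'.1) :
    WhiteheadMoves E (mk t) (mk t') := by
  induction E generalizing t with
  | nil => exact congrArg _ (Subtype.ext h)
  | cons A E ih =>
    obtain ⟨s, hs, h⟩ := h
    let s' : PlaneLabeledTree n := ⟨s, hs.labels_eq.symm.trans t.2⟩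
    exact ⟨mk s', ⟨t, s', rfl, rfl, hs⟩, ih s' h⟩

theorem simultaneousMove_of_oneStep (t t' : PlaneLabeledTree n)
    (h : PlaneTree.OneStep t.1 t'.1) :
    SimultaneousMove (mk t) (mk t') := by
  obtain ⟨s, s', h₁, h₂, h₃⟩ := h
  have hs : s.labels = Multiset.range (n + 1) := h₁.labels_eq.symm.trans t.2
  have hs' : s'.labels = Multiset.range (n + 1) := h₂.labels_eq.symm.trans hs
  have e : (mk t) = mk ⟨s, hs⟩ := mk_eq_mk h₁
  have e' : mk ⟨s', hs'⟩ = mk t' := mk_eq_mk h₃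
  rw [e, ← e']
  obtain ⟨E, hE, hE'⟩ := h₂.exists_reopens (hs ▸ Multiset.nodup_range _)
  exact ⟨E, hE.1, hE.2, whiteheadMoves_of_reopens ⟨s, hs⟩ ⟨s', hs'⟩ hE'⟩

theorem edist_le_one_of_simultaneousMove {T T' : LabeledTree n} (h : SimultaneousMove T T') :
    (simultaneousGraph n).edist T T' ≤ 1 := by
  by_cases e : T = T'
  · simp [e]
  · exact (SimpleGraph.edist_eq_one_iff_adj.2
      ((SimpleGraph.fromRel_adj _ _ _).2 ⟨e, .inl h⟩)).le

theorem edist_le_of_steps {k : ℕ} (t t' : PlaneLabeledTree n)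
    (h : PlaneTree.Steps k t.1 t'.1) :
    (simultaneousGraph n).edist (mk t) (mk t') ≤ k := by
  induction k generalizing t with
  | zero =>
    have e : (mk t) = mk t' := mk_eq_mk h
    simp [e]
  | succ k ih =>
    obtain ⟨s, h₁, h₂⟩ := h
    let s' : PlaneLabeledTree n := ⟨s, h₁.labels_eq.symm.trans t.2⟩
    refine (SimpleGraph.edist_triangle (v := (mk s'))).trans ?_
    rw [Nat.cast_succ, add_comm]
    exact add_le_add (ih s' h₂) (edist_le_one_of_simultaneousMove
      (simultaneousMove_of_oneStep t s' h₁))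

theorem exists_edist_trie_le {L : ℕ} (hL : n < 2 ^ L) : ∃ U : LabeledTree n,
    ∀ t : PlaneLabeledTree n,
      (simultaneousGraph n).edist (mk t) U ≤ (3 * (t.1.height + L) : ℕ) := by
  have key (t : PlaneLabeledTree n) : ∃ u,
      PlaneTree.trie (Multiset.range (n + 1)) L 0 = some u ∧
        PlaneTree.Steps (3 * (t.1.height + L)) t.1 u := by
    have := PlaneTree.exists_steps_trie (t := t.1) (L := L)
      (by rw [t.2]; exact Multiset.nodup_range _)
      fun i hi => by
        rw [t.2, Multiset.mem_range] at hi
        omega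
    rwa [t.2] at this
  -- Any tree would do here: the trie is the same for all, and one instance shows that it is
  -- nonempty and correctly labeled.
  obtain ⟨u, hu, hs⟩ := key ⟨_, PlaneTree.labels_binaryExpansion n⟩
  refine ⟨mk ⟨u, hs.labels_eq.symm.trans (PlaneTree.labels_binaryExpansion n)⟩,
    fun t => edist_le_of_steps _ _ ?_⟩
  obtain ⟨v, hv, hs'⟩ := key t
  rw [hu] at hv
  cases hv
  exact hs'

/-- Both trees are sorted into the common trie; the fully-sorted one has height at most `L + 1`, so
it contributes `3 * (2 * L + 1)`. -/
theorem edist_fullySorted_le_height {L : ℕ} (hL : n < 2 ^ L) (T : LabeledTree n) :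
    (simultaneousGraph n).edist T (fullySorted n) ≤ (3 * T.height + 9 * L + 3 : ℕ) := by
  obtain ⟨U, hU⟩ := exists_edist_trie_le hL
  obtain ⟨t, rfl⟩ := mk_surjective T
  have h₁ := hU t
  have h₂ : (simultaneousGraph n).edist (fullySorted n) U ≤ _ :=
    hU ⟨_, PlaneTree.labels_binaryExpansion n⟩
  have h₃ := PlaneTree.height_binaryExpansion_le hL
  rw [SimpleGraph.edist_comm] at h₂
  refine (SimpleGraph.edist_triangle (v := U)).trans ((add_le_add h₁ h₂).trans ?_)
  rw [← Nat.cast_add, Nat.cast_le]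
  change _ ≤ 3 * t.1.height + _ + _
  dsimp only
  omega

/-- Balancing costs `3 * L` moves and leaves height at most `3 * L + 1`, from which sorting takes
`18 * L + 6`. -/
theorem edist_fullySorted_le {L : ℕ} (hL : n < 2 ^ L) (T : LabeledTree n) :
    (simultaneousGraph n).edist T (fullySorted n) ≤ (21 * L + 6 : ℕ) := by
  obtain ⟨t, rfl⟩ := mk_surjective T
  obtain ⟨u, h₁, h₂⟩ := PlaneTree.Cluster.exists_steps_height_le L (.ofTree t.1) (by
    rw [PlaneTree.Cluster.size_ofTree, t.2, Multiset.card_range]; exact hL)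
  rw [PlaneTree.Cluster.expand_ofTree] at h₁
  rw [PlaneTree.Cluster.leafHeight_ofTree] at h₂
  let u' : PlaneLabeledTree n := ⟨u, h₁.labels_eq.symm.trans t.2⟩
  have h₃ := edist_fullySorted_le_height hL (mk u')
  refine (SimpleGraph.edist_triangle (v := (mk u'))).trans
    ((add_le_add (edist_le_of_steps t u' h₁) h₃).trans ?_)
  rw [← Nat.cast_add, Nat.cast_le]
  change _ + (3 * u.height + _ + _) ≤ _
  omega

/-- As `log 1 = 0`, the bound `C * log n` leaves no room at `n = 1`: the space must be a single
point. -/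
theorem eq_fullySorted_one (T : LabeledTree 1) : T = fullySorted 1 := by
  suffices h : ∀ t : PlaneLabeledTree 1,
      PlaneTree.Iso t.1 (.node (.leaf 0) (.leaf 1)) by
    obtain ⟨t, rfl⟩ := mk_surjective T
    exact mk_eq_mk ((h t).trans (h ⟨_, PlaneTree.labels_binaryExpansion 1⟩).symm)
  rintro ⟨t, ht⟩
  have hc := congrArg Multiset.card ht
  have hpos (s : PlaneTree) : 0 < s.labels.card := Multiset.card_pos.2 s.labels_ne_zero
  match t, ht, hc with
  | .leaf i, _, hc => simp [PlaneTree.labels] at hc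
  | .node (.node a b) c, _, hc =>
    have := hpos a
    have := hpos b
    have := hpos c
    simp [PlaneTree.labels] at hc
    omega
  | .node c (.node a b), _, hc =>
    have := hpos a
    have := hpos b
    have := hpos c
    simp [PlaneTree.labels] at hc
    omega
  | .node (.leaf i) (.leaf j), ht, _ =>
    have hn : (({i} : Multiset ℕ) + {j}).Nodup := by
      rw [show ({i} : Multiset ℕ) + {j} = Multiset.range 2 from ht]
      exact Multiset.nodup_range 2
    have hi : i ∈ Multiset.range 2 := by
      rw [show Multiset.range 2 = {i} + {j} from ht.symm]; simp
    have hj : j ∈ Multiset.range 2 := by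
      rw [show Multiset.range 2 = {i} + {j} from ht.symm]; simp
    rw [Multiset.mem_range] at hi hj
    have hij : i ≠ j := by rintro rfl; simp at hn
    obtain ⟨rfl, rfl⟩ | ⟨rfl, rfl⟩ : i = 0 ∧ j = 1 ∨ i = 1 ∧ j = 0 := by omega
    · exact .refl _
    · exact .swap_node _ _

/-! ### Logarithmic bounds. -/

/-- A bound for the distance of any tree to the fully-sorted tree. -/
def sortingTime (n : ℕ) : ℕ := if n = 1 then 0 else 21 * (Nat.log 2 n + 1) + 6

theorem edist_fullySorted_le_sortingTime (T : LabeledTree n) :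
    (simultaneousGraph n).edist T (fullySorted n) ≤ sortingTime n := by
  unfold sortingTime
  split_ifs with h
  · subst h
    simp [eq_fullySorted_one T]
  · exact edist_fullySorted_le (Nat.lt_pow_succ_log_self one_lt_two n) T

theorem natLog_le_logb (n : ℕ) : (Nat.log 2 n : ℝ) ≤ Real.logb 2 n := by
  exact_mod_cast Real.natLog_le_logb n 2

theorem sortingTime_le (hn : 1 ≤ n) : (sortingTime n : ℝ) ≤ 48 / Real.log 2 * Real.log n := by
  unfold sortingTime
  split_ifs with h
  · simp [h]
  · have h₁ : 1 ≤ Nat.log 2 n := Nat.log_pos one_lt_two (by omega)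
    have h₂ := natLog_le_logb n
    rw [Real.logb] at h₂
    -- The additive constant `27` is absorbed because `Nat.log 2 n ≥ 1`, which gives `48 = 21 + 27`.
    calc ((21 * (Nat.log 2 n + 1) + 6 : ℕ) : ℝ) ≤ (48 * Nat.log 2 n : ℕ) := by
          exact_mod_cast (by omega)
      _ ≤ 48 * (Real.log n / Real.log 2) := by push_cast; linarith
      _ = _ := by ring

theorem reachable_and_dist_le (hn : 1 ≤ n) (T : LabeledTree n) :
    (simultaneousGraph n).Reachable T (fullySorted n) ∧
      ((simultaneousGraph n).dist T (fullySorted n) : ℝ) ≤ 48 / Real.log 2 * Real.log n := by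
  have h := edist_fullySorted_le_sortingTime T
  -- `dist` takes the default value `0` between unreachable vertices, so the bound is carried in
  -- `edist`, which also yields connectedness.
  refine ⟨SimpleGraph.reachable_of_edist_ne_top (ne_top_of_le_ne_top (ENat.natCast_ne_top _) h),
    le_trans ?_ (sortingTime_le hn)⟩
  exact_mod_cast ENat.toNat_le_of_le_natCast h

theorem ediam_le_sortingTime (n : ℕ) :
    (simultaneousGraph n).ediam ≤ (2 * sortingTime n : ℕ) := by
  refine SimpleGraph.ediam_le_of_edist_le fun T T' => ?_
  have h := edist_fullySorted_le_sortingTime T'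
  rw [SimpleGraph.edist_comm] at h
  refine SimpleGraph.edist_triangle.trans
    ((add_le_add (edist_fullySorted_le_sortingTime T) h).trans_eq ?_)
  rw [← Nat.cast_add, two_mul]

theorem height_fullySorted_le (hn : 2 ≤ n) :
    ((fullySorted n).height : ℝ) ≤ 6 * Real.logb 2 n := by
  have h₁ : 1 ≤ Nat.log 2 n := Nat.log_pos one_lt_two hn
  have h₂ : (fullySorted n).height ≤ Nat.log 2 n + 1 + 1 :=
    PlaneTree.height_binaryExpansion_le (Nat.lt_pow_succ_log_self one_lt_two n)
  have h₃ : ((fullySorted n).height : ℝ) ≤ (6 * Nat.log 2 n : ℕ) := by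
    exact_mod_cast (by omega)
  push_cast at h₃
  linarith [natLog_le_logb n]

end LabeledTree

theorem mainTheorem5 :
    (∃ C : ℝ, ∀ n : ℕ, 1 ≤ n →
      (LabeledTree.simultaneousGraph n).ediam ≠ ⊤ ∧
      ((LabeledTree.simultaneousGraph n).diam : ℝ) ≤ C * Real.log n) ∧
    (∃ C : ℝ, ∀ n : ℕ, 2 ≤ n → ∀ T : LabeledTree n, ∃ T' : LabeledTree n,
      (T'.height : ℝ) ≤ 6 * Real.logb 2 n ∧
      (LabeledTree.simultaneousGraph n).Reachable T T' ∧
      ((LabeledTree.simultaneousGraph n).dist T T' : ℝ) ≤ C * Real.log n) ∧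
    (∃ C : ℝ, ∀ n : ℕ, 1 ≤ n → ∀ T : LabeledTree n, (T.height : ℝ) ≤ 6 * Real.logb 2 n →
      (LabeledTree.simultaneousGraph n).Reachable T (LabeledTree.fullySorted n) ∧
      ((LabeledTree.simultaneousGraph n).dist T (LabeledTree.fullySorted n) : ℝ)
        ≤ C * Real.log n) := by
  refine ⟨⟨2 * (48 / Real.log 2), fun n hn => ⟨?_, ?_⟩⟩,
    ⟨48 / Real.log 2, fun n hn T => ⟨LabeledTree.fullySorted n,
      LabeledTree.height_fullySorted_le hn, LabeledTree.reachable_and_dist_le (by omega) T⟩⟩,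
    ⟨48 / Real.log 2, fun n hn T _ => LabeledTree.reachable_and_dist_le hn T⟩⟩
  · exact ne_top_of_le_ne_top (ENat.natCast_ne_top _) (LabeledTree.ediam_le_sortingTime n)
  · have h₁ : (LabeledTree.simultaneousGraph n).diam ≤ 2 * LabeledTree.sortingTime n :=
      ENat.toNat_le_of_le_natCast (LabeledTree.ediam_le_sortingTime n)
    have h₂ : ((LabeledTree.simultaneousGraph n).diam : ℝ) ≤ 2 * LabeledTree.sortingTime n := by
      exact_mod_cast h₁
    linarith [LabeledTree.sortingTime_le hn]
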